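/- All Banach spaces are real. The norm of a Banach space $X$ is called octahedral if for every finite-dimensional subspace $E\subseteq X$ and every $\varepsilon>0$ there is $y\in X$ with $\|y\|=1$ such that $\|x+\lambda y\|\ge(1-\varepsilon)(\|x\|+|\lambda|)$ for all $x\in E$ and all $\lambda\in\mathbb{R}$. Let $\ell_1$ be the space of absolutely summable real sequences, $L_1=L_1[0,1]$ (Lebesgue measure), and $\ell_p^n=(\mathbb{R}^n,\|\cdot\|_p)$. For Banach spaces $X,Y$ let $X\widehat{\otimes}_\varepsilon Y$ be their injective tensor product, i.e. the completion of the algebraic tensor product $X\otimes Y$ under the norm $\bigl\|\sum_i x_i\otimes y_i\bigr\|_\varepsilon=\sup\bigl\{\bigl|\sum_i f(x_i)g(y_i)\bigr| : f\in X^*,\ g\in Y^*,\ \|f\|\le1,\ \|g\|\le1\bigr\}$. Proposition. Let $n\ge3$ be a natural number and $2\le p\le\infty$. Then the norms of both $\ell_1\widehat{\otimes}_\varepsilon\ell_p^n$ and $L_1\widehat{\otimes}_\varepsilon\ell_p^n$ are octahedral. -/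

import Mathlib

open scoped TensorProduct ENNReal

set_option maxSynthPendingDepth 3

noncomputable section

/-- The norm of a real normed space `X` is octahedral. -/
def OctahedralNorm (X : Type*) [NormedAddCommGroup X] [NormedSpace ℝ X] : Prop :=
  ∀ (E : Submodule ℝ X), FiniteDimensional ℝ E → ∀ ε : ℝ, 0 < ε →
    ∃ y : X, ‖y‖ = 1 ∧
      ∀ x ∈ E, ∀ t : ℝ, (1 - ε) * (‖x‖ + |t|) ≤ ‖x + t • y‖

section Injective

variable (X Y : Type*) [NormedAddCommGroup X] [NormedSpace ℝ X]
  [NormedAddCommGroup Y] [NormedSpace ℝ Y]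

/-- The algebraic tensor product `X ⊗ Y`, as a type of its own that will carry the injective
norm (and no other norm). -/
def InjAlgTensor : Type _ := X ⊗[ℝ] Y

instance : AddCommGroup (InjAlgTensor X Y) := inferInstanceAs (AddCommGroup (X ⊗[ℝ] Y))

instance : Module ℝ (InjAlgTensor X Y) := inferInstanceAs (Module ℝ (X ⊗[ℝ] Y))

/-- The canonical map of `X ⊗ Y` into the bounded bilinear forms on `X* × Y*`; it sends
`x ⊗ y` to the form `(f, g) ↦ f x * g y`. -/
def tensorToBilin :
    X ⊗[ℝ] Y →ₗ[ℝ] (StrongDual ℝ X →L[ℝ] StrongDual ℝ Y →L[ℝ] ℝ) :=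
  TensorProduct.lift <| LinearMap.mk₂ ℝ
    (fun x y => (NormedSpace.inclusionInDoubleDual ℝ X x).smulRight
      (NormedSpace.inclusionInDoubleDual ℝ Y y))
    (fun x x' y => by ext f g; simp [add_mul])
    (fun c x y => by ext f g; simp [mul_assoc])
    (fun x y y' => by ext f g; simp)
    (fun c x y => by ext f g; simp [mul_left_comm])

/-- The injective norm: the norm induced from the bounded bilinear forms on `X* × Y*`, that is
`‖∑ xᵢ ⊗ yᵢ‖ = sup {|∑ f xᵢ * g yᵢ| : ‖f‖ ≤ 1, ‖g‖ ≤ 1}`. -/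
instance : SeminormedAddCommGroup (InjAlgTensor X Y) :=
  SeminormedAddCommGroup.induced (InjAlgTensor X Y)
    (StrongDual ℝ X →L[ℝ] StrongDual ℝ Y →L[ℝ] ℝ) (tensorToBilin X Y)

instance : NormedSpace ℝ (InjAlgTensor X Y) where
  norm_smul_le c z :=
    (congrArg norm ((tensorToBilin X Y).map_smul c z)).trans_le (norm_smul_le c _)

/-- The injective tensor product: the completion of `X ⊗ Y` in the injective norm. -/
abbrev InjTensor : Type _ := UniformSpace.Completion (InjAlgTensor X Y)

end Injective

/-- The real sequence space `ℓ_1`. -/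
abbrev SeqL1 : Type := lp (fun _ : ℕ => ℝ) 1

/-- The real space `L_1 = L_1[0,1]` for Lebesgue measure. -/
abbrev FunL1 : Type :=
  MeasureTheory.Lp ℝ 1 (MeasureTheory.volume.restrict (Set.Icc (0 : ℝ) 1))

/-- The space `ℓ_p^n`: `ℝ^n` with the `p`-norm. -/
abbrev FinLp (p : ℝ≥0∞) (n : ℕ) : Type := PiLp p (fun _ : Fin n => ℝ)

end

/-! By Hahn–Banach the injective norm of a tensor `z` is the supremum of `‖tensorSlice f z‖` over
the unit ball of `Y*`. Suppose that `X` is octahedral and that finitely many `y_j` in `Y` satisfy `∑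
|f y_j| ≈ ‖f‖` for every `f`. Choose `v_j` in `X` one after another, each almost `ℓ₁`-orthogonal to
the slices of the given tensors and to the earlier `v_i`. The witness is `S = ∑ v_j ⊗ y_j`: its
slice at `f` is `∑ f y_j • v_j`, of norm about `‖f‖` and almost `ℓ₁`-orthogonal to the slice of `z`.
Testing `z + t • S` on an `f` that almost norms `z` gives octahedrality
(`OctahedralNorm.injTensor`).

It remains to find such `y_j` in `ℓ_p^n`, that is, to embed the dual `ℓ_q^n`, `1 ≤ q ≤ 2`, almost
isometrically into some `ℓ₁^k`. This is the classical embedding of `ℓ_q` into `L₁`, obtained here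
from positive definite functions instead of stable random variables. The function `|t|^q` is a limit
of functions `c 0 - c t` with `c` a positive combination of cosines. Such combinations are closed
under products, so `exp (-∑ |f (e i)|^q)` is a limit of positive combinations of functions `cos (f
y)`. For `q > 1`, integrating one minus this exponential along the ray `u • f` against `u⁻²` gives a
multiple of the `q`-norm, while the same integral of `1 - cos (u * f y)` is a multiple of `|f y|`.
Hence the `q`-norm is a pointwise limit of finite sums of `|f y|` (`exists_absCone_tendsto`), and
compactness of the sphere makes the limit uniform (`exists_list_near_dual_norm`). -/

/-! ### Criteria for octahedrality. -/

/-- To show that a norm is octahedral it is enough to consider finite subsets of a dense set, and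
a small additive error is harmless. -/
theorem OctahedralNorm.of_dense {X : Type*} [NormedAddCommGroup X] [NormedSpace ℝ X] (D : Set X)
    (hD : Dense D) (h0 : (0 : X) ∈ D)
    (h : ∀ F : Set X, F.Finite → F ⊆ D → ∀ ε : ℝ, 0 < ε → ∃ y : X, ‖y‖ ≤ 1 ∧
      ∀ x ∈ F, ∀ t : ℝ, (1 - ε) * (‖x‖ + |t|) - ε ≤ ‖x + t • y‖) :
    OctahedralNorm X := by
  intro E hE ε hε
  set δ : ℝ := min (ε / 4) (1 / 4) with hδ
  have hδ0 : 0 < δ := by positivity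
  have hδε : 4 * δ ≤ ε := by linarith [min_le_left (ε / 4) (1 / 4)]
  have hδ1 : 4 * δ ≤ 1 := by linarith [min_le_right (ε / 4) (1 / 4)]
  have hK : IsCompact ((fun x : E => (x : X)) '' Metric.sphere 0 1) :=
    (isCompact_sphere _ _).image continuous_subtype_val
  obtain ⟨F, hFD, hF, hcov⟩ := hK.elim_finite_subcover_image (b := D)
    (c := fun d => Metric.ball d δ) (fun _ _ => Metric.isOpen_ball) (by
      intro x _
      obtain ⟨d, hd, hxd⟩ := hD.exists_dist_lt x hδ0
      exact Set.mem_biUnion hd hxd)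
  -- The point `0` is added because `x = 0`, `t = 1` gives `‖y‖ ≥ 1 - 2δ > 0`, so that `y` can be
  -- normalised.
  obtain ⟨y, hy1, hy⟩ := h (insert 0 F) (hF.insert 0) (Set.insert_subset h0 hFD) δ hδ0
  have hy0 : 0 < ‖y‖ := by
    have := hy 0 (Set.mem_insert _ _) 1
    simp only [norm_zero, abs_one, one_smul, zero_add] at this
    linarith
  have key : ∀ x ∈ E, ‖x‖ = 1 → ∀ t : ℝ, (1 - ε) * (1 + |t|) ≤ ‖x + t • y‖ := by
    intro x hx hx1 t
    have hmem := hcov ⟨⟨x, hx⟩, by simpa using hx1, rfl⟩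
    simp only [Set.mem_iUnion] at hmem
    obtain ⟨d, hd, hxd⟩ := hmem
    have h1 := hy d (Set.mem_insert_of_mem _ hd) t
    have h2 : ‖x - d‖ < δ := by simpa [dist_eq_norm] using hxd
    have h3 : ‖d + t • y‖ ≤ ‖x + t • y‖ + ‖x - d‖ := by
      have : d + t • y = (x + t • y) - (x - d) := by abel
      rw [this]; exact norm_sub_le _ _
    have h4 : ‖x‖ ≤ ‖d‖ + ‖x - d‖ := by
      have : x = d + (x - d) := by abel
      conv_lhs => rw [this]
      exact norm_add_le _ _
    have := abs_nonneg t
    nlinarith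
  refine ⟨‖y‖⁻¹ • y, by rw [norm_smul, norm_inv, norm_norm, inv_mul_cancel₀ hy0.ne'], ?_⟩
  intro x hx t
  rcases eq_or_ne x 0 with rfl | hx0
  · rw [norm_zero, zero_add, zero_add, norm_smul, norm_smul, norm_inv, norm_norm,
      inv_mul_cancel₀ hy0.ne', mul_one, Real.norm_eq_abs]
    nlinarith [abs_nonneg t]
  · have hxn : 0 < ‖x‖ := norm_pos_iff.mpr hx0
    have h1 := key (‖x‖⁻¹ • x) (E.smul_mem _ hx)
      (by rw [norm_smul, norm_inv, norm_norm, inv_mul_cancel₀ hxn.ne']) (‖x‖⁻¹ * (t * ‖y‖⁻¹))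
    rw [mul_smul, ← smul_add, norm_smul, norm_inv, norm_norm, abs_mul, abs_inv, abs_norm] at h1
    have h2 : (1 - ε) * (‖x‖ + |t * ‖y‖⁻¹|) ≤ ‖x + (t * ‖y‖⁻¹) • y‖ := by
      have := mul_le_mul_of_nonneg_left h1 hxn.le
      rw [mul_inv_cancel_left₀ hxn.ne'] at this
      refine le_trans (le_of_eq ?_) this
      field_simp
    rw [smul_smul]
    -- Since `‖y‖ ≤ 1`, normalising `y` only enlarges the coefficient. This helps when `ε ≤ 1`; for
    -- `ε ≥ 1` the left side is nonpositive.
    have h3 : |t| ≤ |t * ‖y‖⁻¹| := by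
      rw [abs_mul, abs_inv, abs_norm]
      exact le_mul_of_one_le_right (abs_nonneg t) ((one_le_inv₀ hy0).mpr hy1)
    rcases le_total ε 1 with he | he
    · nlinarith
    · nlinarith [norm_nonneg (x + (t * ‖y‖⁻¹) • y), abs_nonneg t]

/-- A sequence of vectors that is asymptotically `ℓ₁`-orthogonal to every vector witnesses that
the norm is octahedral. -/
theorem OctahedralNorm.of_seq {X : Type*} [NormedAddCommGroup X] [NormedSpace ℝ X] (y : ℕ → X)
    (hy : ∀ k, ‖y k‖ ≤ 1)
    (h : ∀ x : X, ∀ ε : ℝ, 0 < ε → ∀ᶠ k in Filter.atTop, ∀ t : ℝ, ‖x‖ + |t| - ε ≤ ‖x + t • y k‖) :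
    OctahedralNorm X := by
  refine OctahedralNorm.of_dense Set.univ dense_univ (Set.mem_univ _) ?_
  intro F hF _ ε hε
  obtain ⟨k, hk⟩ := ((Filter.eventually_all_finite hF).mpr fun x _ => h x ε hε).exists
  refine ⟨y k, hy k, fun x hx t => le_trans ?_ (hk x hx t)⟩
  nlinarith [norm_nonneg x, abs_nonneg t]

/-! ### Octahedrality of `ℓ₁` and `L₁`. -/

/-- The unit vectors work: `x` and `x + t • e_k` agree off coordinate `k`, and `x k → 0`. -/
theorem octahedralNorm_seqL1 : OctahedralNorm SeqL1 := by
  have hp : (0 : ℝ) < (1 : ℝ≥0∞).toReal := by simp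
  refine OctahedralNorm.of_seq (fun k => lp.single 1 k (1 : ℝ)) (fun k => ?_) ?_
  · rw [lp.norm_single (by simp)]; simp
  intro x ε hε
  have hx : Filter.Tendsto (fun k => ‖x k‖) Filter.atTop (nhds 0) := by
    have := (lp.memℓp x).summable hp
    simpa using this.tendsto_atTop_zero
  filter_upwards [hx.eventually (gt_mem_nhds (half_pos hε))] with k hk t
  have key : ∀ w : SeqL1, ‖w - lp.single 1 k (w k)‖ = ‖w‖ - ‖w k‖ := by
    intro w
    simpa using lp.norm_compl_sum_single hp w {k}
  have h1 := key (x + t • lp.single 1 k (1 : ℝ))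
  have h2 := key x
  have happ : ∀ i, (x + t • lp.single 1 k (1 : ℝ) : SeqL1) i
      = x i + t * (lp.single 1 k (1 : ℝ) : SeqL1) i := fun _ => rfl
  have h3 : (x + t • lp.single 1 k (1 : ℝ) : SeqL1) k = x k + t := by rw [happ]; simp
  have h4 : (x + t • lp.single 1 k (1 : ℝ) : SeqL1) - lp.single 1 k (x k + t)
      = x - lp.single 1 k (x k) := by
    ext i
    change (x + t • lp.single 1 k (1 : ℝ) : SeqL1) i - (lp.single 1 k (x k + t) : SeqL1) i
      = x i - (lp.single 1 k (x k) : SeqL1) i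
    rw [happ]
    rcases eq_or_ne i k with rfl | hik
    · simp
    · simp [hik]
  rw [h3, h4, h2] at h1
  have h5 : |t| ≤ ‖x k + t‖ + ‖x k‖ := by
    simpa using norm_sub_le (x k + t) (x k)
  linarith

-- The normalised indicators of `[0, 1/(k+1)]` work: by absolute continuity of the integral the mass
-- of `x` on these intervals tends to `0`, and only that mass can cancel.
open MeasureTheory in
theorem octahedralNorm_funL1 : OctahedralNorm FunL1 := by
  set μ : Measure ℝ := volume.restrict (Set.Icc (0 : ℝ) 1) with hμ
  set s : ℕ → Set ℝ := fun k => Set.Icc 0 (1 / ((k : ℝ) + 1)) with hs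
  have hsm : ∀ k, MeasurableSet (s k) := fun k => measurableSet_Icc
  have hμs : ∀ k, μ (s k) = ENNReal.ofReal (1 / ((k : ℝ) + 1)) := by
    intro k
    have h1 : (1 : ℝ) / ((k : ℝ) + 1) ≤ 1 := by
      rw [div_le_one (by positivity)]; linarith [(Nat.cast_nonneg k : (0 : ℝ) ≤ k)]
    rw [hμ, Measure.restrict_apply (hsm k),
      Set.inter_eq_left.mpr (Set.Icc_subset_Icc le_rfl h1), Real.volume_Icc, sub_zero]
  have hfin : ∀ k, μ (s k) ≠ ∞ := fun k => by rw [hμs]; exact ENNReal.ofReal_ne_top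
  have hreal : ∀ k, μ.real (s k) = 1 / ((k : ℝ) + 1) := fun k => by
    rw [Measure.real, hμs, ENNReal.toReal_ofReal (by positivity)]
  have hnorm : ∀ k, ‖(indicatorConstLp 1 (hsm k) (hfin k) ((k : ℝ) + 1) : FunL1)‖ = 1 := by
    intro k
    have : (0 : ℝ) < (k : ℝ) + 1 := by positivity
    rw [norm_indicatorConstLp one_ne_zero ENNReal.one_ne_top, hreal]
    simp [abs_of_pos this, this.ne']
  refine OctahedralNorm.of_seq
    (fun k => indicatorConstLp 1 (hsm k) (hfin k) ((k : ℝ) + 1)) (fun k => (hnorm k).le) ?_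
  intro x ε hε
  have hxi : Integrable (fun a => ‖x a‖) μ := (L1.integrable_coeFn x).norm
  have hx : Filter.Tendsto (fun k => ∫ a in s k, ‖x a‖ ∂μ) Filter.atTop (nhds 0) := by
    refine hxi.tendsto_setIntegral_nhds_zero ?_
    simp only [Function.comp_def, hμs]
    have := ENNReal.tendsto_ofReal (tendsto_one_div_add_atTop_nhds_zero_nat (𝕜 := ℝ))
    rwa [ENNReal.ofReal_zero] at this
  filter_upwards [hx.eventually (gt_mem_nhds (half_pos hε))] with k hk t
  have hyk := hnorm k
  set y : FunL1 := indicatorConstLp 1 (hsm k) (hfin k) ((k : ℝ) + 1) with hy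
  have hyi : Integrable (fun a => ‖y a‖) μ := (L1.integrable_coeFn y).norm
  have hle : ∫ a, (‖x a‖ + |t| * ‖y a‖ - 2 * (s k).indicator (fun a => ‖x a‖) a) ∂μ
      ≤ ∫ a, ‖(x + t • y : FunL1) a‖ ∂μ := by
    refine integral_mono_ae ?_ (L1.integrable_coeFn _).norm ?_
    · exact (hxi.add (hyi.const_mul _)).sub ((hxi.indicator (hsm k)).const_mul _)
    · filter_upwards [Lp.coeFn_add x (t • y), Lp.coeFn_smul t y,
        indicatorConstLp_coeFn (p := 1) (hs := hsm k) (hμs := hfin k) (c := (k : ℝ) + 1)]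
        with a h1 h2 h3
      rw [← hy] at h3
      rw [h1, Pi.add_apply, h2, Pi.smul_apply, h3]
      by_cases ha : a ∈ s k
      · simp only [Set.indicator_of_mem ha, smul_eq_mul, Real.norm_eq_abs]
        have := abs_sub (x a + t * ((k : ℝ) + 1)) (x a)
        rw [add_sub_cancel_left, abs_mul] at this
        linarith
      · simp [Set.indicator_of_notMem ha]
  have hsum : Integrable (fun a => ‖x a‖ + |t| * ‖y a‖) μ := hxi.add (hyi.const_mul _)
  rw [integral_sub hsum ((hxi.indicator (hsm k)).const_mul _),
    integral_add hxi (hyi.const_mul _), integral_const_mul, integral_const_mul,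
    integral_indicator (hsm k), ← L1.norm_eq_integral_norm, ← L1.norm_eq_integral_norm,
    ← L1.norm_eq_integral_norm, hyk] at hle
  linarith

/-! ### Slices and the injective norm. -/

section Slice

variable {X Y : Type*} [NormedAddCommGroup X] [NormedSpace ℝ X]
  [NormedAddCommGroup Y] [NormedSpace ℝ Y]

/-- The slice map `x ⊗ y ↦ f y • x` of a functional `f` on `Y`. -/
noncomputable def tensorSlice (f : StrongDual ℝ Y) : X ⊗[ℝ] Y →ₗ[ℝ] X :=
  (TensorProduct.rid ℝ X).toLinearMap ∘ₗ TensorProduct.map LinearMap.id f.toLinearMap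

@[simp]
theorem tensorSlice_tmul (f : StrongDual ℝ Y) (x : X) (y : Y) :
    tensorSlice f (x ⊗ₜ[ℝ] y) = f y • x := by
  simp [tensorSlice]

theorem tensorToBilin_apply (z : X ⊗[ℝ] Y) (g : StrongDual ℝ X) (f : StrongDual ℝ Y) :
    tensorToBilin X Y z g f = g (tensorSlice f z) := by
  induction z with
  | zero => simp
  | tmul x y => simp [tensorToBilin, mul_comm]
  | add z w hz hw => simp [hz, hw]

theorem tensorSlice_smul_left (c : ℝ) (f : StrongDual ℝ Y) (z : X ⊗[ℝ] Y) :
    tensorSlice (c • f) z = c • tensorSlice f z := by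
  induction z with
  | zero => simp
  | tmul x y => simp [mul_smul]
  | add z w hz hw => simp [hz, hw]

theorem exists_finiteDimensional_tensorSlice_mem (z : X ⊗[ℝ] Y) :
    ∃ G : Submodule ℝ X, FiniteDimensional ℝ G ∧ ∀ f : StrongDual ℝ Y, tensorSlice f z ∈ G := by
  induction z with
  | zero => exact ⟨⊥, inferInstance, fun f => by simp⟩
  | tmul x y =>
    refine ⟨Submodule.span ℝ {x}, inferInstance, fun f => ?_⟩
    rw [tensorSlice_tmul]
    exact Submodule.smul_mem _ _ (Submodule.mem_span_singleton_self x)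
  | add z w hz hw =>
    obtain ⟨G, _, hG⟩ := hz
    obtain ⟨H, _, hH⟩ := hw
    refine ⟨G ⊔ H, inferInstance, fun f => ?_⟩
    rw [map_add]
    exact Submodule.add_mem_sup (hG f) (hH f)

/-- An element of `X ⊗ Y` in the injective norm. -/
def toInj (z : X ⊗[ℝ] Y) : InjAlgTensor X Y := z

theorem norm_toInj (z : X ⊗[ℝ] Y) : ‖toInj z‖ = ‖tensorToBilin X Y z‖ := rfl

/-- Together with `norm_tensorSlice_le`, where Hahn–Banach enters, this identifies the injective
norm with the operator norm of `f ↦ tensorSlice f z`. -/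
theorem norm_toInj_le {z : X ⊗[ℝ] Y} {C : ℝ} (hC : 0 ≤ C)
    (h : ∀ f : StrongDual ℝ Y, ‖tensorSlice f z‖ ≤ C * ‖f‖) : ‖toInj z‖ ≤ C := by
  rw [norm_toInj]
  refine ContinuousLinearMap.opNorm_le_bound₂ _ hC fun g f => ?_
  rw [tensorToBilin_apply]
  calc ‖g (tensorSlice f z)‖ ≤ ‖g‖ * ‖tensorSlice f z‖ := g.le_opNorm _
    _ ≤ ‖g‖ * (C * ‖f‖) := by gcongr; exact h f
    _ = C * ‖g‖ * ‖f‖ := by ring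

theorem norm_tensorSlice_le (z : X ⊗[ℝ] Y) (f : StrongDual ℝ Y) :
    ‖tensorSlice f z‖ ≤ ‖toInj z‖ * ‖f‖ := by
  refine NormedSpace.norm_le_dual_bound ℝ _ (by positivity) fun g => ?_
  rw [← tensorToBilin_apply, norm_toInj]
  calc _ ≤ _ := (tensorToBilin X Y z).le_opNorm₂ g f
    _ = _ := by ring

theorem exists_lt_norm_tensorSlice [Nontrivial Y] (z : X ⊗[ℝ] Y) {δ : ℝ} (hδ : 0 < δ) :
    ∃ f : StrongDual ℝ Y, f ≠ 0 ∧ (‖toInj z‖ - δ) * ‖f‖ ≤ ‖tensorSlice f z‖ := by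
  by_contra! h
  obtain ⟨y, hy⟩ := exists_ne (0 : Y)
  obtain ⟨f₀, hf₀⟩ := exists_dual_vector ℝ y (norm_ne_zero_iff.mpr hy)
  have hf0 : f₀ ≠ 0 := by
    rintro rfl
    simpa using hf₀.1
  -- A nonpositive constant cannot be fed to `norm_toInj_le`; there any nonzero functional, such as
  -- `f₀`, already contradicts `h`.
  rcases le_total (‖toInj z‖ - δ) 0 with h0 | h0
  · have := h f₀ hf0
    nlinarith [norm_nonneg f₀, norm_nonneg (tensorSlice f₀ z)]
  · have := norm_toInj_le (z := z) h0 fun f => by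
      rcases eq_or_ne f 0 with rfl | hf
      · simpa using (norm_tensorSlice_le z 0)
      · exact (h f hf).le
    linarith

end Slice

/-! ### Octahedrality of the injective tensor product. -/

section Tensor

variable {X Y : Type*} [NormedAddCommGroup X] [NormedSpace ℝ X]
  [NormedAddCommGroup Y] [NormedSpace ℝ Y]

/-- In a space with octahedral norm one can place, almost `ℓ₁`-orthogonally to a given
finite-dimensional subspace, the image of `f ↦ (f y)_{y ∈ l}` in `ℓ₁`. -/
theorem OctahedralNorm.exists_tensor (hX : OctahedralNorm X) (l : List Y) :
    ∀ G : Submodule ℝ X, FiniteDimensional ℝ G → ∀ ε : ℝ, 0 < ε → ε ≤ 1 →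
      ∃ S : X ⊗[ℝ] Y, ∀ f : StrongDual ℝ Y,
        ‖tensorSlice f S‖ ≤ (l.map fun y => |f y|).sum ∧
        ∀ x ∈ G, (1 - ε) * (‖x‖ + (l.map fun y => |f y|).sum) ≤ ‖x + tensorSlice f S‖ := by
  induction l with
  | nil =>
    intro G _ ε hε _
    refine ⟨0, fun f => ⟨by simp, fun x _ => ?_⟩⟩
    simp only [List.map_nil, List.sum_nil, add_zero, map_zero]
    nlinarith [norm_nonneg x]
  | cons y l ih =>
    intro G hG ε hε hε1
    obtain ⟨S, hS⟩ := ih G hG (ε / 2) (by positivity) (by linarith)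
    obtain ⟨H, hH, hSH⟩ := exists_finiteDimensional_tensorSlice_mem S
    -- `G ⊔ H` contains `x + tensorSlice f S` for all `x ∈ G` and all `f` at once. The two losses
    -- combine through `(1 - ε/2)² ≥ 1 - ε`.
    obtain ⟨v, hv1, hv⟩ := hX (G ⊔ H) inferInstance (ε / 2) (by positivity)
    refine ⟨S + v ⊗ₜ y, fun f => ⟨?_, fun x hx => ?_⟩⟩
    · rw [map_add, tensorSlice_tmul, List.map_cons, List.sum_cons]
      have h1 := norm_add_le (tensorSlice f S) (f y • v)
      rw [norm_smul, hv1, mul_one, Real.norm_eq_abs] at h1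
      linarith [(hS f).1]
    · rw [map_add, tensorSlice_tmul, List.map_cons, List.sum_cons]
      have h1 := hv _ (Submodule.add_mem_sup hx (hSH f)) (f y)
      rw [add_assoc] at h1
      have h2 := (hS f).2 x hx
      have h3 : 0 ≤ ‖x‖ + (l.map fun y => |f y|).sum :=
        add_nonneg (norm_nonneg _) (List.sum_nonneg (by simp))
      refine le_trans ?_ h1
      have h4 := abs_nonneg (f y)
      have h5 : (1 - ε / 2) * ((1 - ε / 2) * (‖x‖ + (l.map fun y => |f y|).sum) + |f y|) ≤
          (1 - ε / 2) * (‖x + tensorSlice f S‖ + |f y|) := by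
        have : 0 ≤ 1 - ε / 2 := by linarith
        gcongr
      nlinarith [mul_nonneg (sq_nonneg ε) h3, mul_nonneg hε.le h4]

/-- If the norm of `X` is octahedral and `Y*` embeds almost isometrically into the spaces
`ℓ₁ⁿ`, then the norm of the injective tensor product of `X` and `Y` is octahedral. -/
theorem OctahedralNorm.injTensor (hX : OctahedralNorm X) [Nontrivial Y]
    (hY : ∀ ε : ℝ, 0 < ε → ∃ l : List Y, ∀ f : StrongDual ℝ Y,
      (1 - ε) * ‖f‖ ≤ (l.map fun y => |f y|).sum ∧ (l.map fun y => |f y|).sum ≤ ‖f‖) :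
    OctahedralNorm (InjTensor X Y) := by
  refine OctahedralNorm.of_dense
    (Set.range fun z : X ⊗[ℝ] Y => ((toInj z : InjAlgTensor X Y) : InjTensor X Y))
    (UniformSpace.Completion.denseRange_coe (α := InjAlgTensor X Y))
    ⟨0, UniformSpace.Completion.coe_zero⟩ ?_
  intro F hF hFD ε hε
  set δ : ℝ := min (ε / 2) 1 with hδ
  have hδ0 : 0 < δ := by positivity
  have hδε : 2 * δ ≤ ε := by linarith [min_le_left (ε / 2) 1]
  have hδ1 : δ ≤ 1 := min_le_right _ _
  have hG : ∃ G : Submodule ℝ X, FiniteDimensional ℝ G ∧ ∀ u ∈ F, ∃ z : X ⊗[ℝ] Y,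
      ((toInj z : InjAlgTensor X Y) : InjTensor X Y) = u ∧
        ∀ f : StrongDual ℝ Y, tensorSlice f z ∈ G := by
    induction F, hF using Set.Finite.induction_on with
    | empty => exact ⟨⊥, inferInstance, by simp⟩
    | @insert a s _ _ ih =>
      obtain ⟨G, _, hG⟩ := ih fun u hu => hFD (Set.mem_insert_of_mem _ hu)
      obtain ⟨z, hz⟩ := hFD (Set.mem_insert _ _)
      obtain ⟨H, _, hH⟩ := exists_finiteDimensional_tensorSlice_mem z
      refine ⟨G ⊔ H, inferInstance, fun u hu => ?_⟩
      rcases hu with rfl | hu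
      · exact ⟨z, hz, fun f => Submodule.mem_sup_right (hH f)⟩
      · obtain ⟨w, hw, hwG⟩ := hG u hu
        exact ⟨w, hw, fun f => Submodule.mem_sup_left (hwG f)⟩
  obtain ⟨G, hGfin, hG⟩ := hG
  obtain ⟨l, hl⟩ := hY δ hδ0
  obtain ⟨S, hS⟩ := hX.exists_tensor l G hGfin δ hδ0 hδ1
  refine ⟨((toInj S : InjAlgTensor X Y) : InjTensor X Y), ?_, ?_⟩
  · rw [UniformSpace.Completion.norm_coe]
    exact norm_toInj_le zero_le_one fun f => by
      rw [one_mul]; exact (hS f).1.trans (hl f).2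
  · intro u hu t
    obtain ⟨z, rfl, hz⟩ := hG u hu
    rw [← UniformSpace.Completion.coe_smul, ← UniformSpace.Completion.coe_add,
      UniformSpace.Completion.norm_coe, UniformSpace.Completion.norm_coe]
    change _ ≤ ‖toInj (z + t • S)‖
    obtain ⟨f, hf0, hf⟩ := exists_lt_norm_tensorSlice z hδ0
    have hfn : 0 < ‖f‖ := norm_pos_iff.mpr hf0
    have h1 := norm_tensorSlice_le (z + t • S) f
    -- The slice of `S` is taken at `t • f` and that of `z` at `f`; their sum is the slice of `z + t
    -- • S` at `f`.
    have h2 := (hS (t • f)).2 _ (hz f)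
    have h3 := (hl (t • f)).1
    rw [norm_smul, Real.norm_eq_abs] at h3
    rw [map_add, map_smul] at h1
    rw [tensorSlice_smul_left] at h2
    have h4 : (1 - δ) * ((‖toInj z‖ - δ) * ‖f‖ + (1 - δ) * (|t| * ‖f‖)) ≤
        ‖toInj (z + t • S)‖ * ‖f‖ := by
      refine le_trans ?_ (h2.trans h1)
      have : 0 ≤ 1 - δ := by linarith
      gcongr
    have h5 : (1 - δ) * ((‖toInj z‖ - δ) + (1 - δ) * |t|) ≤ ‖toInj (z + t • S)‖ :=
      le_of_mul_le_mul_right (by linarith) hfn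
    refine le_trans ?_ h5
    have h6 := norm_nonneg (toInj z)
    have h7 := abs_nonneg t
    nlinarith [mul_nonneg hδ0.le h6, mul_nonneg (sq_nonneg δ) h7, mul_nonneg hδ0.le h7,
      mul_nonneg (sub_nonneg.mpr hδε) h6, mul_nonneg (sub_nonneg.mpr hδε) h7]

end Tensor

/-! ### Integrals against the weight `x ^ (-1 - r)`. -/

section PowerWeight

open MeasureTheory Set

/-- Boundedness controls infinity because `r > 0`; decay of order `a > r` controls the singularity
at `0`. -/
theorem integrableOn_mul_rpow_Ioi {F : ℝ → ℝ} (hF : AEStronglyMeasurable F) {A a r : ℝ}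
    (hr : 0 < r) (ha : r < a) (h1 : ∀ x, 0 < x → |F x| ≤ A) (h2 : ∀ x, 0 < x → |F x| ≤ A * x ^ a) :
    IntegrableOn (fun x => F x * x ^ (-1 - r)) (Ioi 0) := by
  have hm : AEStronglyMeasurable (fun x : ℝ => F x * x ^ (-1 - r)) :=
    hF.mul (measurable_id.pow_const _).aestronglyMeasurable
  rw [← Ioc_union_Ioi_eq_Ioi (zero_le_one' ℝ)]
  refine IntegrableOn.union ?_ ?_
  · have : IntegrableOn (fun x : ℝ => A * x ^ (a - 1 - r)) (Ioc 0 1) := by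
      have := (intervalIntegral.intervalIntegrable_rpow' (a := 0) (b := 1)
        (show -1 < a - 1 - r by linarith)).const_mul A
      rwa [intervalIntegrable_iff_integrableOn_Ioc_of_le zero_le_one] at this
    refine Integrable.mono' this hm.restrict ?_
    filter_upwards [ae_restrict_mem measurableSet_Ioc] with x hx
    rw [Real.norm_eq_abs, abs_mul, abs_of_nonneg (Real.rpow_nonneg hx.1.le _),
      show a - 1 - r = a + (-1 - r) by ring, Real.rpow_add hx.1, ← mul_assoc]
    exact mul_le_mul_of_nonneg_right (h2 x hx.1) (Real.rpow_nonneg hx.1.le _)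
  · have : IntegrableOn (fun x : ℝ => A * x ^ (-1 - r)) (Ioi 1) :=
      (integrableOn_Ioi_rpow_of_lt (by linarith) zero_lt_one).const_mul A
    refine Integrable.mono' this hm.restrict ?_
    filter_upwards [ae_restrict_mem measurableSet_Ioi] with x hx
    have hx0 : (0 : ℝ) < x := zero_lt_one.trans hx
    rw [Real.norm_eq_abs, abs_mul, abs_of_nonneg (Real.rpow_nonneg hx0.le _)]
    exact mul_le_mul_of_nonneg_right (h1 x hx0) (Real.rpow_nonneg hx0.le _)

theorem integral_comp_mul_rpow_Ioi (F : ℝ → ℝ) (r : ℝ) {t : ℝ} (ht : 0 < t) :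
    ∫ x in Ioi (0 : ℝ), F (t * x) * x ^ (-1 - r) =
      t ^ r * ∫ x in Ioi (0 : ℝ), F x * x ^ (-1 - r) := by
  have h := integral_comp_mul_left_Ioi (fun x => F x * x ^ (-1 - r)) 0 ht
  rw [mul_zero, smul_eq_mul] at h
  have h2 : ∫ x in Ioi (0 : ℝ), F (t * x) * (t * x) ^ (-1 - r) =
      t ^ (-1 - r) * ∫ x in Ioi (0 : ℝ), F (t * x) * x ^ (-1 - r) := by
    rw [← integral_const_mul]
    refine setIntegral_congr_fun measurableSet_Ioi fun x hx => ?_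
    rw [Real.mul_rpow ht.le (le_of_lt hx)]
    ring
  rw [h2] at h
  have h3 : t ^ r * (t * t ^ (-1 - r)) = 1 := by
    nth_rewrite 2 [← Real.rpow_one t]
    rw [← Real.rpow_add ht, ← Real.rpow_add ht, show r + (1 + (-1 - r)) = 0 by ring,
      Real.rpow_zero]
  have h4 : t * t⁻¹ = 1 := mul_inv_cancel₀ ht.ne'
  linear_combination (t ^ r * t) * h
    - (∫ x in Ioi (0 : ℝ), F (t * x) * x ^ (-1 - r)) * h3
    + t ^ r * (∫ x in Ioi (0 : ℝ), F x * x ^ (-1 - r)) * h4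

theorem integral_comp_mul_rpow_Ioi_of_even {F : ℝ → ℝ} (hF : ∀ x, F (-x) = F x) (hF0 : F 0 = 0)
    {r : ℝ} (hr : 0 < r) (t : ℝ) :
    ∫ x in Ioi (0 : ℝ), F (t * x) * x ^ (-1 - r) =
      |t| ^ r * ∫ x in Ioi (0 : ℝ), F x * x ^ (-1 - r) := by
  rcases eq_or_ne t 0 with rfl | ht
  · simp [hF0, Real.zero_rpow hr.ne']
  · rw [← integral_comp_mul_rpow_Ioi F r (abs_pos.mpr ht)]
    refine setIntegral_congr_fun measurableSet_Ioi fun x _ => ?_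
    rcases abs_choice t with h | h
    · rw [h]
    · rw [h, neg_mul, hF]

theorem integral_mul_rpow_Ioi_pos {F : ℝ → ℝ} {r : ℝ}
    (hi : IntegrableOn (fun x => F x * x ^ (-1 - r)) (Ioi 0))
    (h0 : ∀ x, 0 < x → 0 ≤ F x) (h1 : ∀ x ∈ Ioc (0 : ℝ) 1, 0 < F x) :
    0 < ∫ x in Ioi (0 : ℝ), F x * x ^ (-1 - r) := by
  rw [setIntegral_pos_iff_support_of_nonneg_ae ?_ hi]
  · refine lt_of_lt_of_le ?_ (measure_mono (s := Ioc (0 : ℝ) 1) ?_)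
    · simp
    · intro x hx
      exact ⟨(mul_pos (h1 x hx) (Real.rpow_pos_of_pos hx.1 _)).ne', hx.1⟩
  · filter_upwards [ae_restrict_mem measurableSet_Ioi] with x hx
    exact mul_nonneg (h0 x hx) (Real.rpow_nonneg (le_of_lt hx) _)

theorem Real.one_sub_cos_le_sq (x : ℝ) : 1 - Real.cos x ≤ x ^ 2 / 2 := by
  linarith [Real.one_sub_sq_div_two_le_cos (x := x)]

theorem integrableOn_one_sub_cos_mul_rpow {r : ℝ} (hr : 0 < r) (hr2 : r < 2) (t : ℝ) :
    IntegrableOn (fun x => (1 - Real.cos (t * x)) * x ^ (-1 - r)) (Ioi 0) := by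
  refine integrableOn_mul_rpow_Ioi (A := max 2 (t ^ 2 / 2)) (a := 2)
    (by fun_prop : Continuous fun x => 1 - Real.cos (t * x)).aestronglyMeasurable hr hr2 ?_ ?_
  · intro x _
    rw [abs_of_nonneg (by linarith [Real.cos_le_one (t * x)])]
    exact le_trans (by linarith [Real.neg_one_le_cos (t * x)]) (le_max_left _ _)
  · intro x _
    rw [abs_of_nonneg (by linarith [Real.cos_le_one (t * x)]), Real.rpow_two]
    calc _ ≤ (t * x) ^ 2 / 2 := Real.one_sub_cos_le_sq _
      _ = t ^ 2 / 2 * x ^ 2 := by ring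
      _ ≤ _ := by gcongr; exact le_max_right _ _

theorem integral_one_sub_cos_mul_rpow {r : ℝ} (hr : 0 < r) (t : ℝ) :
    ∫ x in Ioi (0 : ℝ), (1 - Real.cos (t * x)) * x ^ (-1 - r) =
      |t| ^ r * ∫ x in Ioi (0 : ℝ), (1 - Real.cos x) * x ^ (-1 - r) :=
  integral_comp_mul_rpow_Ioi_of_even (F := fun x => 1 - Real.cos x) (by simp) (by simp) hr t

theorem integral_one_sub_cos_mul_rpow_pos {r : ℝ} (hr : 0 < r) (hr2 : r < 2) :
    0 < ∫ x in Ioi (0 : ℝ), (1 - Real.cos x) * x ^ (-1 - r) := by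
  refine integral_mul_rpow_Ioi_pos (by simpa using integrableOn_one_sub_cos_mul_rpow hr hr2 1)
    (fun x _ => by linarith [Real.cos_le_one x]) fun x hx => ?_
  have := Real.cos_lt_cos_of_nonneg_of_le_pi (x := 0) (y := x) le_rfl
    (by linarith [hx.2, Real.pi_gt_three]) hx.1
  rw [Real.cos_zero] at this
  linarith

end PowerWeight

/-! ### The cones of cosines and of absolute values. -/

section Cones

open scoped NNReal

/-- The convex cone spanned by the functions `t ↦ cos (x t)` on the line. -/
def cosConeReal : Submodule ℝ≥0 (ℝ → ℝ) :=
  Submodule.span ℝ≥0 (Set.range fun (x : ℝ) (t : ℝ) => Real.cos (t * x))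

variable (Y : Type*) [NormedAddCommGroup Y] [NormedSpace ℝ Y]

/-- The convex cone spanned by the functions `f ↦ cos (f y)` on the dual of `Y`. -/
def cosCone : Submodule ℝ≥0 (StrongDual ℝ Y → ℝ) :=
  Submodule.span ℝ≥0 (Set.range fun (y : Y) (f : StrongDual ℝ Y) => Real.cos (f y))

/-- The convex cone spanned by the functions `f ↦ |f y|` on the dual of `Y`. -/
def absCone : Submodule ℝ≥0 (StrongDual ℝ Y → ℝ) :=
  Submodule.span ℝ≥0 (Set.range fun (y : Y) (f : StrongDual ℝ Y) => |f y|)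

variable {Y}

theorem cos_mem_cosConeReal (x : ℝ) : (fun t => Real.cos (t * x)) ∈ cosConeReal :=
  Submodule.subset_span ⟨x, rfl⟩

theorem abs_le_of_mem_cosConeReal {c : ℝ → ℝ} (hc : c ∈ cosConeReal) (t : ℝ) : |c t| ≤ c 0 := by
  induction hc using Submodule.span_induction with
  | mem c hc =>
    obtain ⟨x, rfl⟩ := hc
    simpa using Real.abs_cos_le_one _
  | zero => simp
  | add c d _ _ hc hd => exact (abs_add_le _ _).trans (add_le_add hc hd)
  | smul a c _ hc =>
    simp only [Pi.smul_apply, NNReal.smul_def, smul_eq_mul, abs_mul, NNReal.abs_eq]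
    gcongr

theorem comp_mem_cosCone {c : ℝ → ℝ} (hc : c ∈ cosConeReal) (y : Y) :
    (fun f : StrongDual ℝ Y => c (f y)) ∈ cosCone Y := by
  induction hc using Submodule.span_induction with
  | mem c hc =>
    obtain ⟨x, rfl⟩ := hc
    refine Submodule.subset_span ⟨x • y, ?_⟩
    ext f
    simp [mul_comm]
  | zero => exact zero_mem _
  | add c d _ _ hc hd => exact add_mem hc hd
  | smul a c _ hc => exact Submodule.smul_mem _ a hc

theorem one_mem_cosCone : (1 : StrongDual ℝ Y → ℝ) ∈ cosCone Y :=
  Submodule.subset_span ⟨0, by ext f; simp⟩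

/-- On generators this is `2 cos a cos b = cos (a - b) + cos (a + b)`. -/
theorem mul_mem_cosCone {φ ψ : StrongDual ℝ Y → ℝ} (hφ : φ ∈ cosCone Y) (hψ : ψ ∈ cosCone Y) :
    φ * ψ ∈ cosCone Y := by
  induction hφ using Submodule.span_induction with
  | mem φ hφ =>
    obtain ⟨x, rfl⟩ := hφ
    induction hψ using Submodule.span_induction with
    | mem ψ hψ =>
      obtain ⟨y, rfl⟩ := hψ
      have : ((fun f => Real.cos (f x)) * fun f => Real.cos (f y) : StrongDual ℝ Y → ℝ) =
          (2⁻¹ : ℝ≥0) • ((fun f => Real.cos (f (x - y))) + fun f => Real.cos (f (x + y))) := by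
        ext f
        simp only [Pi.mul_apply, Pi.smul_apply, Pi.add_apply, map_sub, map_add, Real.cos_sub,
          Real.cos_add, NNReal.smul_def, smul_eq_mul, NNReal.coe_inv, NNReal.coe_ofNat]
        ring
      rw [this]
      exact Submodule.smul_mem _ _ (add_mem (Submodule.subset_span ⟨_, rfl⟩)
        (Submodule.subset_span ⟨_, rfl⟩))
    | zero => rw [mul_zero]; exact zero_mem _
    | add φ ψ _ _ h1 h2 => rw [mul_add]; exact add_mem h1 h2
    | smul a φ _ h => rw [mul_smul_comm]; exact Submodule.smul_mem _ a h
  | zero => rw [zero_mul]; exact zero_mem _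
  | add φ ψ _ _ h1 h2 => rw [add_mul]; exact add_mem h1 h2
  | smul a φ _ h => rw [smul_mul_assoc]; exact Submodule.smul_mem _ a h

theorem pow_mem_cosCone {φ : StrongDual ℝ Y → ℝ} (hφ : φ ∈ cosCone Y) (k : ℕ) :
    φ ^ k ∈ cosCone Y := by
  induction k with
  | zero => rw [pow_zero]; exact one_mem_cosCone
  | succ k ih => rw [pow_succ]; exact mul_mem_cosCone ih hφ

theorem prod_mem_cosCone {ι : Type*} (s : Finset ι) {φ : ι → StrongDual ℝ Y → ℝ}
    (hφ : ∀ i ∈ s, φ i ∈ cosCone Y) : ∏ i ∈ s, φ i ∈ cosCone Y :=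
  Finset.prod_induction _ (· ∈ cosCone Y) (fun _ _ => mul_mem_cosCone) one_mem_cosCone hφ

open MeasureTheory Set in
/-- Integrating `1 - cos` against `u⁻²` turns the cone of cosines into the cone of absolute
values. -/
theorem exists_absCone_of_cosCone {φ : StrongDual ℝ Y → ℝ} (hφ : φ ∈ cosCone Y) :
    ∃ N ∈ absCone Y, ∀ f : StrongDual ℝ Y,
      IntegrableOn (fun u : ℝ => (φ 0 - φ (u • f)) * u ^ (-1 - 1 : ℝ)) (Ioi 0) ∧
      ∫ u in Ioi (0 : ℝ), (φ 0 - φ (u • f)) * u ^ (-1 - 1 : ℝ) = N f := by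
  induction hφ using Submodule.span_induction with
  | mem φ hφ =>
    obtain ⟨y, rfl⟩ := hφ
    set c : ℝ := ∫ x in Ioi (0 : ℝ), (1 - Real.cos x) * x ^ (-1 - 1 : ℝ) with hc
    have hc0 : 0 < c := integral_one_sub_cos_mul_rpow_pos one_pos one_lt_two
    refine ⟨(⟨c, hc0.le⟩ : ℝ≥0) • fun f => |f y|,
      Submodule.smul_mem _ _ (Submodule.subset_span ⟨y, rfl⟩), fun f => ⟨?_, ?_⟩⟩
    · simpa [mul_comm] using integrableOn_one_sub_cos_mul_rpow one_pos one_lt_two (f y)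
    · have := integral_one_sub_cos_mul_rpow one_pos (f y)
      rw [Real.rpow_one, ← hc] at this
      refine Eq.trans ?_ (this.trans (mul_comm _ _))
      simp [mul_comm]
  | zero => exact ⟨0, zero_mem _, fun f => by simp⟩
  | add φ ψ _ _ h1 h2 =>
    obtain ⟨N, hN, h1⟩ := h1
    obtain ⟨M, hM, h2⟩ := h2
    have hs : ∀ f : StrongDual ℝ Y,
        (fun u : ℝ => ((φ + ψ) 0 - (φ + ψ) (u • f)) * u ^ (-1 - 1 : ℝ)) =
        fun u : ℝ => (φ 0 - φ (u • f)) * u ^ (-1 - 1 : ℝ) +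
          (ψ 0 - ψ (u • f)) * u ^ (-1 - 1 : ℝ) := by
      intro f; ext u; simp only [Pi.add_apply]; ring
    refine ⟨N + M, add_mem hN hM, fun f => ?_⟩
    rw [hs]
    exact ⟨(h1 f).1.add (h2 f).1, by rw [integral_add (h1 f).1 (h2 f).1, (h1 f).2, (h2 f).2]; rfl⟩
  | smul a φ _ h =>
    obtain ⟨N, hN, h⟩ := h
    have hs : ∀ f : StrongDual ℝ Y,
        (fun u : ℝ => ((a • φ) 0 - (a • φ) (u • f)) * u ^ (-1 - 1 : ℝ)) =
        fun u : ℝ => (a : ℝ) * ((φ 0 - φ (u • f)) * u ^ (-1 - 1 : ℝ)) := by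
      intro f; ext u; simp only [Pi.smul_apply, NNReal.smul_def, smul_eq_mul]; ring
    refine ⟨a • N, Submodule.smul_mem _ _ hN, fun f => ?_⟩
    rw [hs]
    exact ⟨(h f).1.const_mul _, by rw [integral_const_mul, (h f).2]; rfl⟩

/-- A positive coefficient is absorbed into the vector: `a * |f y| = |f (a • y)|`. -/
theorem exists_list_of_mem_absCone {N : StrongDual ℝ Y → ℝ} (hN : N ∈ absCone Y) :
    ∃ l : List Y, ∀ f, N f = (l.map fun y => |f y|).sum := by
  induction hN using Submodule.span_induction with
  | mem N hN =>
    obtain ⟨y, rfl⟩ := hN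
    exact ⟨[y], by simp⟩
  | zero => exact ⟨[], by simp⟩
  | add N M _ _ h1 h2 =>
    obtain ⟨l, hl⟩ := h1
    obtain ⟨l', hl'⟩ := h2
    exact ⟨l ++ l', fun f => by simp [hl, hl']⟩
  | smul a N _ h =>
    obtain ⟨l, hl⟩ := h
    refine ⟨l.map ((a : ℝ) • ·), fun f => ?_⟩
    simp only [Pi.smul_apply, hl, NNReal.smul_def, smul_eq_mul, List.map_map, Function.comp_def,
      map_smul, abs_mul, NNReal.abs_eq, List.sum_map_mul_left]

/-- Subadditivity turns a common bound `N f ≤ C * ‖f‖` into a common Lipschitz constant, which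
upgrades pointwise to uniform convergence on the sphere. -/
theorem le_add_of_mem_absCone {N : StrongDual ℝ Y → ℝ} (hN : N ∈ absCone Y)
    (f g : StrongDual ℝ Y) : N f ≤ N g + N (f - g) := by
  induction hN using Submodule.span_induction with
  | mem N hN =>
    obtain ⟨y, rfl⟩ := hN
    simpa using abs_add_le (g y) ((f - g) y)
  | zero => simp
  | add N M _ _ h1 h2 => simp only [Pi.add_apply]; linarith
  | smul a N _ h =>
    simp only [Pi.smul_apply, NNReal.smul_def, smul_eq_mul, ← mul_add]
    gcongr

theorem smul_of_mem_absCone {N : StrongDual ℝ Y → ℝ} (hN : N ∈ absCone Y)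
    (c : ℝ) (f : StrongDual ℝ Y) : N (c • f) = |c| * N f := by
  obtain ⟨l, hl⟩ := exists_list_of_mem_absCone hN
  simp [hl, abs_mul, List.sum_map_mul_left]

end Cones

/-! ### Approximating `|t|^q` by positive combinations of cosines. -/

section PowerApprox

open MeasureTheory Set Filter Topology
open scoped NNReal

/-- The integral of `1 - cos (t r(x))` for a simple function `r` differs from a constant by an
element of the cone of cosines. -/
theorem exists_cosConeReal_of_simpleFunc (r : SimpleFunc ℝ ℝ) (μ : Measure ℝ) {w : ℝ → ℝ}
    (hw0 : ∀ᵐ x ∂μ, 0 ≤ w x) (hw : IntegrableOn w {x | r x ≠ 0} μ) :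
    ∃ c ∈ cosConeReal, ∀ t, ∫ x, (1 - Real.cos (t * r x)) * w x ∂μ = c 0 - c t := by
  have hnn : ∀ v, 0 ≤ ∫ x in r ⁻¹' {v}, w x ∂μ := fun v =>
    integral_nonneg_of_ae (ae_restrict_of_ae hw0)
  -- On the fibre `v = 0` the weight may fail to be integrable, so its coefficient may be the
  -- default value `0`. This is harmless, as that term cancels in `c 0 - c t`.
  refine ⟨∑ v ∈ r.range, (⟨∫ x in r ⁻¹' {v}, w x ∂μ, hnn v⟩ : ℝ≥0) • fun t => Real.cos (t * v),
    Submodule.sum_mem _ fun v _ => Submodule.smul_mem _ _ (cos_mem_cosConeReal v), fun t => ?_⟩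
  have hpt : ∀ x, (1 - Real.cos (t * r x)) * w x =
      ∑ v ∈ r.range, (1 - Real.cos (t * v)) * (r ⁻¹' {v}).indicator w x := by
    intro x
    rw [Finset.sum_eq_single (r x)]
    · rw [indicator_of_mem (by simp)]
    · intro v _ hv
      rw [indicator_of_notMem (by simpa using hv.symm), mul_zero]
    · intro h
      exact absurd (SimpleFunc.mem_range_self r x) h
  simp_rw [hpt]
  rw [integral_finsetSum]
  · rw [Finset.sum_apply, Finset.sum_apply, ← Finset.sum_sub_distrib]
    refine Finset.sum_congr rfl fun v _ => ?_
    rw [integral_const_mul, integral_indicator (r.measurableSet_fiber v)]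
    change _ = (∫ x in r ⁻¹' {v}, w x ∂μ) * Real.cos (0 * v) -
      (∫ x in r ⁻¹' {v}, w x ∂μ) * Real.cos (t * v)
    rw [zero_mul, Real.cos_zero]
    ring
  · intro v _
    rcases eq_or_ne v 0 with rfl | hv
    · simp
    · refine Integrable.const_mul ?_ _
      rw [integrable_indicator_iff (r.measurableSet_fiber v)]
      exact hw.mono_set fun x hx => by simpa [show r x = v from hx] using hv

/-- Simple functions increasing to the identity of the half-line, each vanishing near `0`. -/
theorem exists_simpleFunc_tendsto_id :
    ∃ r : ℕ → SimpleFunc ℝ ℝ, (∀ m x, r m x ≠ 0 → 1 / ((m : ℝ) + 1) < x) ∧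
      (∀ m x, 0 < x → 0 ≤ r m x ∧ r m x ≤ x) ∧
      ∀ x, 0 < x → Tendsto (fun m => r m x) atTop (𝓝 x) := by
  have hm : Measurable ENNReal.ofReal := ENNReal.measurable_ofReal
  set s : ℕ → SimpleFunc ℝ ℝ := fun m => (SimpleFunc.eapprox ENNReal.ofReal m).map ENNReal.toReal
    with hs
  have hle : ∀ m x, SimpleFunc.eapprox ENNReal.ofReal m x ≤ ENNReal.ofReal x := fun m x =>
    (le_iSup (fun m => SimpleFunc.eapprox ENNReal.ofReal m x) m).trans
      (SimpleFunc.iSup_eapprox_apply hm x).le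
  have htend : ∀ x, 0 < x → Tendsto (fun m => s m x) atTop (𝓝 x) := by
    intro x hx
    have h1 : Tendsto (fun m => SimpleFunc.eapprox ENNReal.ofReal m x) atTop
        (𝓝 (ENNReal.ofReal x)) := by
      rw [← SimpleFunc.iSup_eapprox_apply hm x]
      exact tendsto_atTop_iSup fun i j hij => SimpleFunc.monotone_eapprox _ hij x
    have h2 := (ENNReal.tendsto_toReal ENNReal.ofReal_ne_top).comp h1
    rw [ENNReal.toReal_ofReal hx.le] at h2
    exact h2
  refine ⟨fun m => (s m).restrict (Ioi (1 / ((m : ℝ) + 1))), fun m x h => ?_, fun m x hx => ?_,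
    fun x hx => ?_⟩
  · by_contra hx
    rw [SimpleFunc.restrict_apply _ measurableSet_Ioi,
      indicator_of_notMem (show x ∉ Ioi _ from hx)] at h
    exact h rfl
  · rw [SimpleFunc.restrict_apply _ measurableSet_Ioi]
    have h0 : 0 ≤ s m x := ENNReal.toReal_nonneg
    have h1 : s m x ≤ x := ENNReal.toReal_le_of_le_ofReal hx.le (hle m x)
    by_cases h : x ∈ Ioi (1 / ((m : ℝ) + 1))
    · rw [indicator_of_mem h]; exact ⟨h0, h1⟩
    · rw [indicator_of_notMem h]; exact ⟨le_rfl, hx.le⟩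
  · refine (htend x hx).congr' ?_
    filter_upwards [(tendsto_one_div_add_atTop_nhds_zero_nat (𝕜 := ℝ)).eventually
      (gt_mem_nhds hx)] with m hm
    rw [SimpleFunc.restrict_apply _ measurableSet_Ioi, indicator_of_mem (by exact hm)]

/-- The function `|t|^q` with `1 < q < 2` is a limit of functions `c 0 - c t`, where `c` is a
positive combination of cosines, dominated by a multiple of `|t|^q`. -/
theorem exists_cosConeReal_tendsto_abs_rpow_of_lt {q : ℝ} (hq0 : 0 < q) (hq2 : q < 2) :
    ∃ (C : ℝ) (c : ℕ → ℝ → ℝ), (∀ m, c m ∈ cosConeReal) ∧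
      (∀ m t, c m 0 - c m t ≤ C * |t| ^ q) ∧
      ∀ t, Tendsto (fun m => c m 0 - c m t) atTop (𝓝 (|t| ^ q)) := by
  obtain ⟨r, hr0, hr1, hr2⟩ := exists_simpleFunc_tendsto_id
  set μ : Measure ℝ := volume.restrict (Ioi 0) with hμ
  set K : ℝ := ∫ x in Ioi (0 : ℝ), (1 - Real.cos x) * x ^ (-1 - q) with hK
  have hK0 : 0 < K := integral_one_sub_cos_mul_rpow_pos hq0 hq2
  -- `B (t * x)` dominates every `1 - cos (t * r m x)`, since `0 ≤ r m x ≤ x`. By scaling its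
  -- weighted integral is a constant times `|t| ^ q`, which supplies `C`.
  set B : ℝ → ℝ := fun x => min 2 (x ^ 2 / 2) with hB
  have hBc : Continuous B := by fun_prop
  have hBn : ∀ x, 0 ≤ B x := fun x => le_min (by norm_num) (by positivity)
  have hBi : ∀ t : ℝ, Integrable (fun x => B (t * x) * x ^ (-1 - q)) μ := by
    intro t
    refine integrableOn_mul_rpow_Ioi (A := max 2 (t ^ 2 / 2)) (a := 2)
      (by fun_prop : Continuous fun x => B (t * x)).aestronglyMeasurable hq0 hq2 ?_ ?_
    · intro x _
      rw [abs_of_nonneg (hBn _)]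
      exact (min_le_left _ _).trans (le_max_left _ _)
    · intro x _
      rw [abs_of_nonneg (hBn _), Real.rpow_two]
      calc _ ≤ (t * x) ^ 2 / 2 := min_le_right _ _
        _ = t ^ 2 / 2 * x ^ 2 := by ring
        _ ≤ _ := by gcongr; exact le_max_right _ _
  have hpos : ∀ᵐ x ∂μ, (0 : ℝ) < x := ae_restrict_mem measurableSet_Ioi
  have hex : ∀ m, ∃ c ∈ cosConeReal, ∀ t,
      ∫ x, (1 - Real.cos (t * r m x)) * x ^ (-1 - q) ∂μ = c 0 - c t := by
    intro m
    refine exists_cosConeReal_of_simpleFunc (r m) μ ?_ ?_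
    · filter_upwards [hpos] with x hx using Real.rpow_nonneg hx.le _
    · have h : IntegrableOn (fun x : ℝ => x ^ (-1 - q)) (Ioi (1 / ((m : ℝ) + 1))) :=
        integrableOn_Ioi_rpow_of_lt (by linarith) (by positivity)
      refine (h.mono_set fun x hx => hr0 m x hx).mono_measure Measure.restrict_le_self
  choose c hc hcint using hex
  have hdom : ∀ m t x, 0 < x → 1 - Real.cos (t * r m x) ≤ B (t * x) := by
    intro m t x hx
    refine le_min (by linarith [Real.neg_one_le_cos (t * r m x)])
      ((Real.one_sub_cos_le_sq _).trans ?_)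
    have h1 := hr1 m x hx
    have h2 : (r m x) ^ 2 ≤ x ^ 2 := pow_le_pow_left₀ h1.1 h1.2 2
    rw [mul_pow, mul_pow]
    have := sq_nonneg t
    gcongr
  have hbd : ∀ m t, ∀ᵐ x ∂μ, ‖(1 - Real.cos (t * r m x)) * x ^ (-1 - q)‖ ≤
      B (t * x) * x ^ (-1 - q) := by
    intro m t
    filter_upwards [hpos] with x hx
    have h1 := Real.rpow_nonneg hx.le (-1 - q)
    rw [Real.norm_eq_abs, abs_of_nonneg
      (mul_nonneg (by linarith [Real.cos_le_one (t * r m x)]) h1)]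
    exact mul_le_mul_of_nonneg_right (hdom m t x hx) h1
  have hmeas : ∀ m t, AEStronglyMeasurable
      (fun x => (1 - Real.cos (t * r m x)) * x ^ (-1 - q)) μ := by
    intro m t
    have := (r m).measurable
    exact (by fun_prop : Measurable fun x => (1 - Real.cos (t * r m x)) * x ^ (-1 - q)
      ).aestronglyMeasurable
  have hmul : ∀ m t, (K⁻¹ * c m 0 - K⁻¹ * c m t) =
      K⁻¹ * ∫ x, (1 - Real.cos (t * r m x)) * x ^ (-1 - q) ∂μ := by
    intro m t
    rw [hcint, mul_sub]
  refine ⟨K⁻¹ * ∫ x in Ioi (0 : ℝ), B x * x ^ (-1 - q),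
    fun m t => K⁻¹ * c m t, fun m => ?_, fun m t => ?_, fun t => ?_⟩
  · exact Submodule.smul_mem _ (⟨K⁻¹, (inv_pos.mpr hK0).le⟩ : ℝ≥0) (hc m)
  · rw [hmul, mul_assoc]
    refine mul_le_mul_of_nonneg_left ?_ (inv_pos.mpr hK0).le
    rw [mul_comm, ← integral_comp_mul_rpow_Ioi_of_even (F := B) (by simp [hB]) (by simp [hB]) hq0]
    refine integral_mono_ae ((hBi t).mono' (hmeas m t) (hbd m t)) (hBi t) ?_
    filter_upwards [hbd m t] with x hx using (le_abs_self _).trans hx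
  · simp_rw [hmul]
    have h1 : |t| ^ q = K⁻¹ * ∫ x, (1 - Real.cos (t * x)) * x ^ (-1 - q) ∂μ := by
      rw [integral_one_sub_cos_mul_rpow hq0, ← hK]
      field_simp
    rw [h1]
    refine Tendsto.const_mul _ (tendsto_integral_of_dominated_convergence _
      (fun m => hmeas m t) (hBi t) (fun m => hbd m t) ?_)
    filter_upwards [hpos] with x hx
    have h2 : Continuous fun y : ℝ => (1 - Real.cos (t * y)) * x ^ (-1 - q) := by fun_prop
    exact (h2.tendsto x).comp (hr2 x hx)

/-- At `q = 2` the weighted integral of `1 - cos` diverges at `0`; the limit `2 m² (1 - cos (t / m))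
→ t²` replaces it. -/
theorem exists_cosConeReal_tendsto_sq :
    ∃ (C : ℝ) (c : ℕ → ℝ → ℝ), (∀ m, c m ∈ cosConeReal) ∧
      (∀ m t, c m 0 - c m t ≤ C * |t| ^ (2 : ℝ)) ∧
      ∀ t, Tendsto (fun m => c m 0 - c m t) atTop (𝓝 (|t| ^ (2 : ℝ))) := by
  refine ⟨1, fun m t => (2 * (m : ℝ) ^ 2) * Real.cos (t * (m : ℝ)⁻¹), fun m => ?_, fun m t => ?_,
    fun t => ?_⟩
  · exact Submodule.smul_mem _ (⟨2 * (m : ℝ) ^ 2, by positivity⟩ : ℝ≥0)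
      (cos_mem_cosConeReal (m : ℝ)⁻¹)
  · beta_reduce
    rw [Real.rpow_two, sq_abs, zero_mul, Real.cos_zero]
    rcases eq_or_ne (m : ℝ) 0 with h | h
    · rw [h]; simp only [ne_eq, OfNat.ofNat_ne_zero, not_false_eq_true, zero_pow]; nlinarith
    · have h1 := Real.one_sub_cos_le_sq (t * (m : ℝ)⁻¹)
      calc _ = 2 * (m : ℝ) ^ 2 * (1 - Real.cos (t * (m : ℝ)⁻¹)) := by ring
        _ ≤ 2 * (m : ℝ) ^ 2 * ((t * (m : ℝ)⁻¹) ^ 2 / 2) := by gcongr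
        _ = _ := by field_simp
  · have h1 : Tendsto (fun m : ℕ => t ^ 2 * Real.sinc (t / 2 * (m : ℝ)⁻¹) ^ 2) atTop
        (𝓝 (t ^ 2 * Real.sinc (t / 2 * 0) ^ 2)) := by
      have : Continuous fun y : ℝ => t ^ 2 * Real.sinc (t / 2 * y) ^ 2 := by
        have := Real.continuous_sinc
        fun_prop
      exact (this.tendsto 0).comp tendsto_inv_atTop_nhds_zero_nat
    rw [mul_zero, Real.sinc_zero, one_pow, mul_one] at h1
    rw [Real.rpow_two, sq_abs]
    refine h1.congr' ?_
    filter_upwards [eventually_gt_atTop 0] with m hm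
    have hm' : (m : ℝ) ≠ 0 := by positivity
    rcases eq_or_ne t 0 with rfl | ht
    · simp
    · rw [Real.sinc_of_ne_zero (by positivity), zero_mul, Real.cos_zero,
        show t * (m : ℝ)⁻¹ = 2 * (t / 2 * (m : ℝ)⁻¹) by ring, Real.cos_two_mul, Real.cos_sq']
      field_simp
      ring

theorem exists_cosConeReal_tendsto_abs_rpow {q : ℝ} (hq0 : 0 < q) (hq2 : q ≤ 2) :
    ∃ (C : ℝ) (c : ℕ → ℝ → ℝ), (∀ m, c m ∈ cosConeReal) ∧
      (∀ m t, c m 0 - c m t ≤ C * |t| ^ q) ∧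
      ∀ t, Tendsto (fun m => c m 0 - c m t) atTop (𝓝 (|t| ^ q)) := by
  rcases hq2.lt_or_eq with h | rfl
  · exact exists_cosConeReal_tendsto_abs_rpow_of_lt hq0 h
  · exact exists_cosConeReal_tendsto_sq

end PowerApprox

/-! ### Almost isometric embedding into `ℓ₁`. -/

section Embedding

open MeasureTheory Set Filter Topology
open scoped NNReal

/-- Comparing `1 - y` with `exp (-y)` for `y = x m / M m` costs at most `y²` per factor, hence `x m
^ 2 / M m → 0` in total. -/
theorem tendsto_one_sub_div_pow_exp {x : ℕ → ℝ} {M : ℕ → ℕ} {l : ℝ} (hx0 : ∀ m, 0 ≤ x m)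
    (hxM : ∀ m, x m ≤ M m) (hM0 : ∀ m, 0 < M m) (hM : Tendsto M atTop atTop)
    (hx : Tendsto x atTop (𝓝 l)) :
    Tendsto (fun m => (1 - x m / M m) ^ M m) atTop (𝓝 (Real.exp (-l))) := by
  have h1 : Tendsto (fun m => Real.exp (-x m)) atTop (𝓝 (Real.exp (-l))) :=
    (Real.continuous_exp.tendsto _).comp hx.neg
  have h2 : Tendsto (fun m => x m ^ 2 / M m) atTop (𝓝 0) :=
    (hx.pow 2).div_atTop (tendsto_natCast_atTop_atTop.comp hM)
  have h3 : Tendsto (fun m => (1 - x m / M m) ^ M m - Real.exp (-x m)) atTop (𝓝 0) := by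
    refine squeeze_zero_norm (fun m => ?_) h2
    have hMp : (0 : ℝ) < M m := by exact_mod_cast hM0 m
    have hy0 : 0 ≤ x m / M m := div_nonneg (hx0 m) hMp.le
    have hy1 : x m / M m ≤ 1 := (div_le_one hMp).mpr (hxM m)
    have he : Real.exp (-x m) = Real.exp (-(x m / M m)) ^ M m := by
      rw [← Real.exp_nat_mul]
      congr 1
      field_simp
    have hb : |1 - x m / M m| ≤ 1 := by rw [abs_le]; constructor <;> linarith
    have hb' : |Real.exp (-(x m / M m))| ≤ 1 := by
      rw [Real.abs_exp]; exact Real.exp_le_one_iff.mpr (by linarith)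
    have hd : |1 - x m / M m - Real.exp (-(x m / M m))| ≤ (x m / M m) ^ 2 := by
      have := Real.abs_exp_sub_one_sub_id_le (x := -(x m / M m))
        (by rw [abs_neg, abs_of_nonneg hy0]; exact hy1)
      rw [neg_sq, ← abs_neg] at this
      convert this using 2
      ring
    rw [he, Real.norm_eq_abs]
    calc _ ≤ |1 - x m / M m - Real.exp (-(x m / M m))| * M m *
          max |1 - x m / M m| |Real.exp (-(x m / M m))| ^ (M m - 1) := abs_pow_sub_pow_le _ _ _
      _ ≤ (x m / M m) ^ 2 * M m * 1 := by
        gcongr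
        exact pow_le_one₀ (le_max_of_le_left (abs_nonneg _)) (max_le hb hb')
      _ = x m ^ 2 / M m := by field_simp
  simpa using h3.add h1

theorem one_sub_prod_le_sum {ι : Type*} (s : Finset ι) {a : ι → ℝ} (h0 : ∀ i, 0 ≤ a i)
    (h1 : ∀ i, a i ≤ 1) : 1 - ∏ i ∈ s, a i ≤ ∑ i ∈ s, (1 - a i) := by
  classical
  induction s using Finset.induction_on with
  | empty => simp
  | insert i s hi ih =>
    rw [Finset.prod_insert hi, Finset.sum_insert hi]
    have hp0 : 0 ≤ ∏ i ∈ s, a i := Finset.prod_nonneg fun i _ => h0 i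
    have hp1 : ∏ i ∈ s, a i ≤ 1 := Finset.prod_le_one (fun i _ => h0 i) fun i _ => h1 i
    nlinarith [h1 i, h0 i]

variable {Y : Type*} [NormedAddCommGroup Y] [NormedSpace ℝ Y]

/-- For `1 < q ≤ 2` the function `exp (-∑ |f (e i)|^q)` is a limit of positive combinations of
cosines, with a uniform control near `0`. -/
theorem exists_cosCone_tendsto_exp {ι : Type*} [Fintype ι] (e : ι → Y) {q : ℝ} (hq0 : 0 < q)
    (hq2 : q ≤ 2) :
    ∃ (C : ℝ) (φ : ℕ → StrongDual ℝ Y → ℝ), 0 ≤ C ∧ (∀ m, φ m ∈ cosCone Y) ∧ (∀ m, φ m 0 = 1) ∧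
      (∀ m f, 0 ≤ φ m f ∧ φ m f ≤ 1) ∧ (∀ m f, 1 - φ m f ≤ C * ∑ i, |f (e i)| ^ q) ∧
      ∀ f, Tendsto (fun m => φ m f) atTop (𝓝 (Real.exp (-∑ i, |f (e i)| ^ q))) := by
  obtain ⟨C, c, hc, hcC, hct⟩ := exists_cosConeReal_tendsto_abs_rpow hq0 hq2
  have hg0 : ∀ m t, 0 ≤ c m 0 - c m t := fun m t =>
    sub_nonneg.mpr ((le_abs_self _).trans (abs_le_of_mem_cosConeReal (hc m) t))
  have hg2 : ∀ m t, c m 0 - c m t ≤ 2 * c m 0 := fun m t => by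
    linarith [neg_le_of_abs_le (abs_le_of_mem_cosConeReal (hc m) t)]
  have hc0 : ∀ m, 0 ≤ c m 0 := fun m => (abs_nonneg _).trans (abs_le_of_mem_cosConeReal (hc m) 0)
  have hC0 : 0 ≤ C := by simpa using (hg0 0 1).trans (hcC 0 1)
  -- The ceiling keeps `a m t` in `[0, 1]` and makes the constant `1 - c m 0 / M m` nonnegative, as
  -- the cone requires; the summand `m` forces `M → ∞`.
  set M : ℕ → ℕ := fun m => ⌈2 * c m 0⌉₊ + m + 1 with hM
  have hM0 : ∀ m, 0 < M m := fun m => Nat.succ_pos _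
  have hMp : ∀ m, (0 : ℝ) < M m := fun m => by exact_mod_cast hM0 m
  have hMc : ∀ m, 2 * c m 0 ≤ M m := fun m => by
    have := Nat.le_ceil (2 * c m 0)
    simp only [hM]
    push_cast
    linarith [(Nat.cast_nonneg m : (0 : ℝ) ≤ m)]
  have hMt : Tendsto M atTop atTop := tendsto_atTop_mono (fun m => by simp only [hM, id]; omega)
    tendsto_id
  set a : ℕ → ℝ → ℝ := fun m t => 1 - (c m 0 - c m t) / M m with ha
  have ha0 : ∀ m t, 0 ≤ a m t := fun m t =>
    sub_nonneg.mpr ((div_le_one (hMp m)).mpr ((hg2 m t).trans (hMc m)))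
  have ha1 : ∀ m t, a m t ≤ 1 := fun m t => by
    have := div_nonneg (hg0 m t) (hMp m).le
    simp only [ha]
    linarith
  have hamem : ∀ m y, (fun f : StrongDual ℝ Y => a m (f y)) ∈ cosCone Y := by
    intro m y
    have h1 : 0 ≤ 1 - c m 0 / M m := sub_nonneg.mpr
      ((div_le_one (hMp m)).mpr (by linarith [hMc m, hc0 m]))
    have h2 : (fun f : StrongDual ℝ Y => a m (f y)) =
        (⟨1 - c m 0 / M m, h1⟩ : ℝ≥0) • (1 : StrongDual ℝ Y → ℝ) +
          (⟨(M m : ℝ)⁻¹, (inv_pos.mpr (hMp m)).le⟩ : ℝ≥0) •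
            fun f : StrongDual ℝ Y => c m (f y) := by
      ext f
      change 1 - (c m 0 - c m (f y)) / M m = (1 - c m 0 / M m) * 1 + (M m : ℝ)⁻¹ * c m (f y)
      ring
    rw [h2]
    exact add_mem (Submodule.smul_mem _ _ one_mem_cosCone)
      (Submodule.smul_mem _ _ (comp_mem_cosCone (hc m) y))
  refine ⟨C, fun m f => ∏ i, a m (f (e i)) ^ M m, hC0, fun m => ?_, fun m => ?_,
    fun m f => ⟨?_, ?_⟩, fun m f => ?_, fun f => ?_⟩
  · have := prod_mem_cosCone Finset.univ fun i _ => pow_mem_cosCone (hamem m (e i)) (M m)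
    convert this using 1
    ext f
    simp
  · simp [ha]
  · exact Finset.prod_nonneg fun i _ => pow_nonneg (ha0 m _) _
  · exact Finset.prod_le_one (fun i _ => pow_nonneg (ha0 m _) _)
      fun i _ => pow_le_one₀ (ha0 m _) (ha1 m _)
  · refine (one_sub_prod_le_sum _ (fun i => pow_nonneg (ha0 m _) _)
      (fun i => pow_le_one₀ (ha0 m _) (ha1 m _))).trans ?_
    rw [Finset.mul_sum]
    refine Finset.sum_le_sum fun i _ => le_trans ?_ (hcC m (f (e i)))
    -- Bernoulli's inequality: `1 - a ^ M ≤ M * (1 - a) = c m 0 - c m t`, a bound in which `M` has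
    -- disappeared.
    have h1 := one_add_mul_le_pow (a := -((c m 0 - c m (f (e i))) / M m))
      (by linarith [ha0 m (f (e i))]) (M m)
    have h2 : (M m : ℝ) * ((c m 0 - c m (f (e i))) / M m) = c m 0 - c m (f (e i)) :=
      mul_div_cancel₀ _ (hMp m).ne'
    rw [mul_neg, h2, ← sub_eq_add_neg, ← sub_eq_add_neg] at h1
    linarith
  · rw [← Finset.sum_neg_distrib, Real.exp_sum]
    exact tendsto_finsetProd _ fun i _ => tendsto_one_sub_div_pow_exp (fun m => hg0 m _)
      (fun m => (hg2 m _).trans (hMc m)) hM0 hMt (hct (f (e i)))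

/-- For `1 ≤ q ≤ 2` the function `(∑ |f (e i)|^q)^(1/q)` is a limit of finite sums of functions
`f ↦ |f y|`. -/
theorem exists_absCone_tendsto {ι : Type*} [Fintype ι] (e : ι → Y) {q : ℝ} (hq1 : 1 ≤ q)
    (hq2 : q ≤ 2) :
    ∃ (C : ℝ) (N : ℕ → StrongDual ℝ Y → ℝ), (∀ m, N m ∈ absCone Y) ∧
      (∀ m f, N m f ≤ C * (∑ i, |f (e i)| ^ q) ^ (1 / q)) ∧
      ∀ f, Tendsto (fun m => N m f) atTop (𝓝 ((∑ i, |f (e i)| ^ q) ^ (1 / q))) := by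
  -- For `q = 1` the integral of `(1 - exp (-u)) * u⁻²` diverges at `0`, but the sum is already in
  -- the cone.
  rcases hq1.eq_or_lt with rfl | hq1
  · refine ⟨1, fun _ => ∑ i, fun f => |f (e i)|, fun _ => Submodule.sum_mem _ fun i _ =>
      Submodule.subset_span ⟨e i, rfl⟩, fun m f => ?_, fun f => ?_⟩
    · simp
    · simp
  have hq0 : 0 < q := by linarith
  obtain ⟨C, φ, hC0, hφ, hφ0, hφ1, hφC, hφt⟩ := exists_cosCone_tendsto_exp e hq0 hq2
  choose N hN hNi hNeq using fun m => exists_absCone_of_cosCone (hφ m)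
  simp only [hφ0] at hNi hNeq
  set s : StrongDual ℝ Y → ℝ := fun f => (∑ i, |f (e i)| ^ q) ^ (1 / q) with hs
  have hψ0 : ∀ f : StrongDual ℝ Y, 0 ≤ ∑ i, |f (e i)| ^ q := fun f =>
    Finset.sum_nonneg fun i _ => Real.rpow_nonneg (abs_nonneg _) _
  have hs0 : ∀ f, 0 ≤ s f := fun f => Real.rpow_nonneg (hψ0 f) _
  -- Along the ray `u • f` everything depends on `s f * u` only, so scaling in `u` extracts the
  -- factor `s f` from the integrals of `F` and `B`.
  have hsq : ∀ (f : StrongDual ℝ Y) (u : ℝ), 0 < u →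
      ∑ i, |(u • f) (e i)| ^ q = |s f * u| ^ q := by
    intro f u hu
    rw [abs_of_nonneg (mul_nonneg (hs0 f) hu.le), Real.mul_rpow (hs0 f) hu.le, hs,
      ← Real.rpow_mul (hψ0 f), one_div_mul_cancel hq0.ne', Real.rpow_one, Finset.sum_mul]
    refine Finset.sum_congr rfl fun i _ => ?_
    rw [smul_apply, smul_eq_mul, abs_mul, abs_of_pos hu,
      Real.mul_rpow hu.le (abs_nonneg _), mul_comm]
  set F : ℝ → ℝ := fun u => 1 - Real.exp (-|u| ^ q) with hF
  have hFc : Continuous F := by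
    have : Continuous fun u : ℝ => |u| ^ q := continuous_abs.rpow_const fun _ => Or.inr hq0.le
    fun_prop
  have hFn : ∀ u, 0 ≤ F u := fun u => sub_nonneg.mpr
    (Real.exp_le_one_iff.mpr (neg_nonpos.mpr (Real.rpow_nonneg (abs_nonneg _) _)))
  have hFi : IntegrableOn (fun u => F u * u ^ (-1 - 1 : ℝ)) (Ioi 0) := by
    refine integrableOn_mul_rpow_Ioi (A := 1) (a := q) hFc.aestronglyMeasurable one_pos hq1 ?_ ?_
    · intro x _
      rw [abs_of_nonneg (hFn x)]
      linarith [Real.exp_pos (-|x| ^ q)]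
    · intro x hx
      rw [abs_of_nonneg (hFn x), one_mul]
      have := Real.add_one_le_exp (-|x| ^ q)
      rw [abs_of_pos hx] at this
      simp only [hF, abs_of_pos hx]
      linarith
  set K : ℝ := ∫ u in Ioi (0 : ℝ), F u * u ^ (-1 - 1 : ℝ) with hK
  have hK0 : 0 < K := by
    refine integral_mul_rpow_Ioi_pos hFi (fun x _ => hFn x) fun x hx => ?_
    exact sub_pos.mpr (Real.exp_lt_one_iff.mpr
      (neg_lt_zero.mpr (Real.rpow_pos_of_pos (abs_pos.mpr hx.1.ne') _)))
  set B : ℝ → ℝ := fun u => min 1 (C * |u| ^ q) with hB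
  have hBn : ∀ u, 0 ≤ B u := fun u =>
    le_min zero_le_one (mul_nonneg hC0 (Real.rpow_nonneg (abs_nonneg _) _))
  have hBc : Continuous B := by
    have : Continuous fun u : ℝ => |u| ^ q := continuous_abs.rpow_const fun _ => Or.inr hq0.le
    fun_prop
  have hBi : ∀ t : ℝ, IntegrableOn (fun u => B (t * u) * u ^ (-1 - 1 : ℝ)) (Ioi 0) := by
    intro t
    refine integrableOn_mul_rpow_Ioi (F := fun u => B (t * u)) (A := max 1 (C * |t| ^ q)) (a := q)
      (hBc.comp (continuous_const.mul continuous_id)).aestronglyMeasurable one_pos hq1 ?_ ?_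
    · intro x _
      rw [abs_of_nonneg (hBn _)]
      exact (min_le_left _ _).trans (le_max_left _ _)
    · intro x hx
      rw [abs_of_nonneg (hBn _)]
      refine (min_le_right _ _).trans ?_
      rw [abs_mul, Real.mul_rpow (abs_nonneg _) (abs_nonneg _), abs_of_pos hx, ← mul_assoc]
      gcongr
      exact le_max_right _ _
  have hbd : ∀ m f, ∀ᵐ u ∂(volume.restrict (Ioi (0 : ℝ))),
      ‖(1 - φ m (u • f)) * u ^ (-1 - 1 : ℝ)‖ ≤ B (s f * u) * u ^ (-1 - 1 : ℝ) := by
    intro m f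
    filter_upwards [ae_restrict_mem measurableSet_Ioi] with u hu
    have h1 := Real.rpow_nonneg (le_of_lt hu) (-1 - 1)
    have h2 := hφ1 m (u • f)
    rw [Real.norm_eq_abs, abs_of_nonneg (mul_nonneg (by linarith) h1)]
    refine mul_le_mul_of_nonneg_right (le_min (by linarith) ?_) h1
    rw [← hsq f u hu]
    exact hφC m _
  refine ⟨K⁻¹ * ∫ u in Ioi (0 : ℝ), B u * u ^ (-1 - 1 : ℝ), fun m f => K⁻¹ * N m f,
    fun m => Submodule.smul_mem _ (⟨K⁻¹, (inv_pos.mpr hK0).le⟩ : ℝ≥0) (hN m),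
    fun m f => ?_, fun f => ?_⟩
  · rw [mul_assoc]
    refine mul_le_mul_of_nonneg_left ?_ (inv_pos.mpr hK0).le
    have h1 := integral_comp_mul_rpow_Ioi_of_even (F := B) (by simp [hB])
      (by simp [hB, Real.zero_rpow hq0.ne']) one_pos (s f)
    rw [Real.rpow_one, abs_of_nonneg (hs0 f)] at h1
    rw [mul_comm, ← h1, ← hNeq]
    refine integral_mono_ae (hNi m f) (hBi _) ?_
    filter_upwards [hbd m f] with x hx using (le_abs_self _).trans hx
  · have h1 := integral_comp_mul_rpow_Ioi_of_even (F := F) (by simp [hF])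
      (by simp [hF, Real.zero_rpow hq0.ne']) one_pos (s f)
    rw [Real.rpow_one, abs_of_nonneg (hs0 f), ← hK] at h1
    have h2 : s f = K⁻¹ * ∫ u in Ioi (0 : ℝ), F (s f * u) * u ^ (-1 - 1 : ℝ) := by
      rw [h1]; field_simp
    change Tendsto _ _ (𝓝 (s f))
    rw [h2]
    refine Tendsto.const_mul _ ?_
    simp_rw [← hNeq]
    refine tendsto_integral_of_dominated_convergence _
      (fun m => (hNi m f).aestronglyMeasurable) (hBi (s f)) (fun m => hbd m f) ?_
    filter_upwards [ae_restrict_mem measurableSet_Ioi] with u hu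
    have h3 := hφt (u • f)
    rw [hsq f u hu] at h3
    exact (h3.const_sub 1).mul_const _

/-- If the dual norm of a finite-dimensional space is a dominated pointwise limit of finite sums of
functions `f ↦ |f y|`, then the dual embeds almost isometrically into the spaces `ℓ₁ⁿ`. -/
theorem exists_list_near_dual_norm [FiniteDimensional ℝ Y] {C : ℝ} {N : ℕ → StrongDual ℝ Y → ℝ}
    (hN : ∀ m, N m ∈ absCone Y) (hC : ∀ m f, N m f ≤ C * ‖f‖)
    (ht : ∀ f, Tendsto (fun m => N m f) atTop (𝓝 ‖f‖)) {ε : ℝ} (hε : 0 < ε) :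
    ∃ l : List Y, ∀ f : StrongDual ℝ Y,
      (1 - ε) * ‖f‖ ≤ (l.map fun y => |f y|).sum ∧ (l.map fun y => |f y|).sum ≤ ‖f‖ := by
  have : ProperSpace (StrongDual ℝ Y) := FiniteDimensional.proper ℝ _
  set η : ℝ := ε / 2 with hη
  have hη0 : 0 < η := by positivity
  -- The error on the sphere is `|C| * δ` from the Lipschitz bound, plus `δ` from convergence on the
  -- net and `δ` from the norm.
  set δ : ℝ := η / (|C| + 2) with hδ
  have hδ0 : 0 < δ := by positivity
  obtain ⟨F, -, hF, hcov⟩ := (isCompact_sphere (0 : StrongDual ℝ Y) 1).finite_cover_balls hδ0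
  obtain ⟨m, hm⟩ := ((eventually_all_finite hF).mpr fun g _ =>
    (ht g).eventually (Metric.ball_mem_nhds _ hδ0)).exists
  have hsph : ∀ f : StrongDual ℝ Y, ‖f‖ = 1 → |N m f - 1| ≤ η := by
    intro f hf
    have hmem := hcov (show f ∈ Metric.sphere 0 1 by simpa using hf)
    simp only [mem_iUnion] at hmem
    obtain ⟨g, hg, hfg⟩ := hmem
    rw [Metric.mem_ball, dist_eq_norm] at hfg
    have h1 := hm g hg
    rw [Real.dist_eq, abs_lt] at h1
    have h2 := le_add_of_mem_absCone (hN m) f g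
    have h3 := le_add_of_mem_absCone (hN m) g f
    have h4 : N m (f - g) ≤ |C| * δ := (hC m _).trans (by gcongr; exact le_abs_self C)
    have h5 : N m (g - f) ≤ |C| * δ := (hC m _).trans (by
      rw [norm_sub_rev]; gcongr; exact le_abs_self C)
    have h6 := abs_le.mp (abs_norm_sub_norm_le f g)
    have h7 : |C| * δ + δ + δ = η := by rw [hδ]; field_simp; ring
    rw [hf] at h6
    rw [abs_le]
    constructor <;> linarith
  have hall : ∀ f : StrongDual ℝ Y, |N m f - ‖f‖| ≤ η * ‖f‖ := by
    intro f
    rcases eq_or_ne f 0 with rfl | hf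
    · have := smul_of_mem_absCone (hN m) 0 0
      rw [zero_smul, abs_zero, zero_mul] at this
      simp [this]
    · have hfn : 0 < ‖f‖ := norm_pos_iff.mpr hf
      have h1 := hsph (‖f‖⁻¹ • f) (by rw [norm_smul, norm_inv, norm_norm, inv_mul_cancel₀ hfn.ne'])
      rw [smul_of_mem_absCone (hN m), abs_inv, abs_norm] at h1
      have h2 : N m f - ‖f‖ = (‖f‖⁻¹ * N m f - 1) * ‖f‖ := by field_simp
      rw [h2, abs_mul, abs_norm]
      gcongr
  -- Dividing by `1 + η` makes the upper bound exact; the lower one survives since `(1 - 2η)(1 + η)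
  -- ≤ 1 - η`.
  obtain ⟨l, hl⟩ := exists_list_of_mem_absCone
    (Submodule.smul_mem _ (⟨(1 + η)⁻¹, by positivity⟩ : ℝ≥0) (hN m))
  refine ⟨l, fun f => ?_⟩
  rw [← hl]
  change (1 - ε) * ‖f‖ ≤ (1 + η)⁻¹ * N m f ∧ (1 + η)⁻¹ * N m f ≤ ‖f‖
  have h1 := abs_le.mp (hall f)
  have hf := norm_nonneg f
  rw [inv_mul_eq_div, le_div_iff₀ (by positivity), div_le_iff₀ (by positivity)]
  constructor
  · have : ε = 2 * η := by rw [hη]; ring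
    rw [this]
    nlinarith [mul_nonneg (sq_nonneg η) hf]
  · linarith

end Embedding

/-! ### The dual norm of `ℓ_p^n` and the conclusion. -/

section DualNorm

variable {n : ℕ}

theorem dual_apply_eq_sum (p : ℝ≥0∞) [Fact (1 ≤ p)] (f : StrongDual ℝ (FinLp p n))
    (x : FinLp p n) : f x = ∑ i, x i * f (PiLp.single p i 1) := by
  have hx : x = ∑ i, x i • (PiLp.single p i (1 : ℝ) : FinLp p n) := by
    ext j
    simp [Pi.single_apply]
  conv_lhs => rw [hx]
  simp

theorem dual_norm_finLp_top (f : StrongDual ℝ (FinLp ∞ n)) :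
    ‖f‖ = ∑ i, |f (PiLp.single ∞ i 1)| := by
  refine le_antisymm ?_ ?_
  · refine f.opNorm_le_bound (Finset.sum_nonneg fun i _ => abs_nonneg _) fun x => ?_
    rw [dual_apply_eq_sum, Finset.sum_mul]
    refine (norm_sum_le _ _).trans (Finset.sum_le_sum fun i _ => ?_)
    rw [norm_mul, mul_comm, Real.norm_eq_abs]
    gcongr
    exact PiLp.norm_apply_le x i
  · set x : FinLp ∞ n := WithLp.toLp ∞ fun i => SignType.sign (f (PiLp.single ∞ i 1)) with hx
    have hx1 : ‖x‖ ≤ 1 := by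
      rw [PiLp.norm_eq_ciSup]
      refine Real.iSup_le (fun i => ?_) zero_le_one
      rw [hx, PiLp.toLp_apply]
      rcases SignType.sign (f (PiLp.single ∞ i 1)) with _ | _ | _ <;> simp
    calc ∑ i, |f (PiLp.single ∞ i 1)| = f x := by
          rw [dual_apply_eq_sum]
          exact Finset.sum_congr rfl fun i _ => (sign_mul_self _).symm
      _ ≤ ‖f‖ * ‖x‖ := (le_abs_self _).trans (f.le_opNorm x)
      _ ≤ ‖f‖ := mul_le_of_le_one_right (norm_nonneg _) hx1

theorem dual_norm_finLp {p : ℝ≥0∞} [Fact (1 ≤ p)] {q : ℝ} (hpq : p.toReal.HolderConjugate q)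
    (f : StrongDual ℝ (FinLp p n)) :
    ‖f‖ = (∑ i, |f (PiLp.single p i 1)| ^ q) ^ (1 / q) := by
  set a : Fin n → ℝ := fun i => f (PiLp.single p i 1) with ha
  set S : ℝ := ∑ i, |a i| ^ q with hS
  have hS0 : 0 ≤ S := Finset.sum_nonneg fun i _ => Real.rpow_nonneg (abs_nonneg _) _
  have hq0 : 0 < q := hpq.symm.pos
  refine le_antisymm ?_ ?_
  · refine f.opNorm_le_bound (Real.rpow_nonneg hS0 _) fun x => ?_
    rw [dual_apply_eq_sum]
    refine (norm_sum_le _ _).trans ?_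
    have := Real.inner_le_Lp_mul_Lq Finset.univ (fun i => |x i|) (fun i => |a i|) hpq
    simp only [abs_abs] at this
    rw [PiLp.norm_eq_sum hpq.pos, mul_comm]
    simpa only [norm_mul, Real.norm_eq_abs] using this
  · rcases hS0.eq_or_lt with h0 | h0
    · rw [← h0, Real.zero_rpow (one_div_pos.mpr hq0).ne']
      exact norm_nonneg _
    -- The extremal vector of Hölder's inequality, with `f x = S` and `‖x‖ = S ^ (1 / p)`.
    set x : FinLp p n := WithLp.toLp p fun i => (SignType.sign (a i) : ℝ) * |a i| ^ (q - 1) with hx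
    have hfx : f x = S := by
      rw [dual_apply_eq_sum]
      refine Finset.sum_congr rfl fun i _ => ?_
      rw [hx, PiLp.toLp_apply]
      change (SignType.sign (a i) : ℝ) * |a i| ^ (q - 1) * a i = _
      rw [mul_right_comm, sign_mul_self]
      rcases (abs_nonneg (a i)).eq_or_lt with h | h
      · rw [← h, zero_mul, Real.zero_rpow hq0.ne']
      · nth_rewrite 1 [← Real.rpow_one |a i|]
        rw [← Real.rpow_add h]
        congr 1
        ring
    have hxn : ‖x‖ = S ^ (1 / p.toReal) := by
      rw [PiLp.norm_eq_sum hpq.pos]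
      congr 1
      refine Finset.sum_congr rfl fun i _ => ?_
      rw [hx, PiLp.toLp_apply]
      rcases eq_or_ne (a i) 0 with h | h
      · simp [h, Real.zero_rpow hq0.ne', Real.zero_rpow hpq.pos.ne']
      · have hs : |(SignType.sign (a i) : ℝ)| = 1 := by
          rcases lt_or_gt_of_ne h with h | h <;> simp [h]
        rw [Real.norm_eq_abs, abs_mul, hs, one_mul,
          abs_of_nonneg (Real.rpow_nonneg (abs_nonneg _) _), ← Real.rpow_mul (abs_nonneg _)]
        congr 1
        have := hpq.symm.sub_one_mul_conj
        linarith
    have h1 := (le_abs_self _).trans (f.le_opNorm x)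
    rw [hfx, hxn] at h1
    have h2 : S = S ^ (1 / q) * S ^ (1 / p.toReal) := by
      rw [← Real.rpow_add h0]
      have := hpq.symm.inv_add_inv_eq_one
      rw [one_div, one_div, this, Real.rpow_one]
    nth_rewrite 1 [h2] at h1
    exact le_of_mul_le_mul_right h1 (Real.rpow_pos_of_pos h0 _)

theorem exists_dual_norm_finLp (p : ℝ≥0∞) [Fact (1 ≤ p)] (hp : 2 ≤ p) :
    ∃ q : ℝ, 1 ≤ q ∧ q ≤ 2 ∧ ∀ f : StrongDual ℝ (FinLp p n),
      ‖f‖ = (∑ i, |f (PiLp.single p i 1)| ^ q) ^ (1 / q) := by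
  rcases eq_or_ne p ∞ with rfl | hpt
  · exact ⟨1, le_rfl, one_le_two, fun f => by simp [dual_norm_finLp_top]⟩
  · have h2 : 2 ≤ p.toReal := by
      simpa using ENNReal.toReal_mono hpt hp
    have hpq := Real.HolderConjugate.conjExponent (p := p.toReal) (by linarith)
    refine ⟨_, hpq.symm.lt.le, ?_, dual_norm_finLp hpq⟩
    rw [Real.conjExponent, div_le_iff₀ (by linarith)]
    linarith

/-- The dual of `ℓ_p^n`, `2 ≤ p ≤ ∞`, embeds almost isometrically into the spaces `ℓ₁ᵏ`. -/
theorem exists_list_near_dual_norm_finLp (p : ℝ≥0∞) [Fact (1 ≤ p)] (hp : 2 ≤ p) {ε : ℝ}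
    (hε : 0 < ε) :
    ∃ l : List (FinLp p n), ∀ f : StrongDual ℝ (FinLp p n),
      (1 - ε) * ‖f‖ ≤ (l.map fun y => |f y|).sum ∧ (l.map fun y => |f y|).sum ≤ ‖f‖ := by
  obtain ⟨q, hq1, hq2, hq⟩ := exists_dual_norm_finLp (n := n) p hp
  obtain ⟨C, N, hN, hC, ht⟩ :=
    exists_absCone_tendsto (fun i : Fin n => (PiLp.single p i (1 : ℝ) : FinLp p n)) hq1 hq2
  simp only [← hq] at hC ht
  exact exists_list_near_dual_norm hN hC ht hε

end DualNorm

theorem mainTheorem9 (n : ℕ) (hn : 3 ≤ n) (p : ℝ≥0∞) [Fact (1 ≤ p)] (hp : 2 ≤ p) :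
    OctahedralNorm (InjTensor SeqL1 (FinLp p n)) ∧
      OctahedralNorm (InjTensor FunL1 (FinLp p n)) := by
  have : Nontrivial (FinLp p n) :=
    ⟨PiLp.single p ⟨0, by omega⟩ 1, 0, by simp [PiLp.single_eq_zero_iff]⟩
  exact ⟨octahedralNorm_seqL1.injTensor fun ε hε => exists_list_near_dual_norm_finLp p hp hε,
    octahedralNorm_funL1.injTensor fun ε hε => exists_list_near_dual_norm_finLp p hp hε⟩
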